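/- Let $(\mathbb S,d)$ be a complete separable metric space with Borel $\sigma$-algebra $\mathcal S$, let $\mathbb C\subset\mathbb S$ be closed, $\mathbb O=\mathbb S\setminus\mathbb C$, and $\mathbb C^r=\{x\in\mathbb S: d(x,\mathbb C)<r\}$ for $r>0$ (with $d(x,\emptyset)=\infty$). Let $\mathbb M_{\mathbb O}$ be the set of Borel measures $\mu$ on $\mathbb O$ with $\mu(\mathbb S\setminus\mathbb C^r)<\infty$ for every $r>0$, and let $\mathcal M_{\mathbb O}$ be the $\sigma$-algebra on $\mathbb M_{\mathbb O}$ generated by the sets $$\Big\{\upsilon\in\mathbb M_{\mathbb O}:\Big|\int f_i\,d\upsilon-\int f_i\,d\mu\Big|<\varepsilon,\ i=1,\dots,k\Big\},$$ where $\mu\in\mathbb M_{\mathbb O}$, $\varepsilon>0$, $k\in\mathbb N$, and each $f_i$ is a non-negative bounded continuous function on $\mathbb O$ vanishing on $\mathbb C^r\cap\mathbb O$ for some $r>0$. Let $\mathbb N_{\mathbb O}\subset\mathbb M_{\mathbb O}$ be the set of those $N$ for which $N(A\setminus\mathbb C^r)$ is a non-negative integer for all $r>0$ and $A\in\mathcal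 S$, with the trace $\sigma$-algebra $\mathcal N_{\mathbb O}$. A random measure (respectively, a point process) is a measurable map from a probability space into $(\mathbb M_{\mathbb O},\mathcal M_{\mathbb O})$ (respectively, $(\mathbb N_{\mathbb O},\mathcal N_{\mathbb O})$). Let $BM(\mathbb S)$ be the set of non-negative bounded measurable functions $f$ on $\mathbb S$ that vanish on $\mathbb C^r$ for some $r>0$, and let $L_\xi[f]=E\big[\exp\big(-\int_{\mathbb O}f\,d\xi\big)\big]$ for $f\in BM(\mathbb S)$. Then the Laplace functionals determine the distribution: if $\xi_1,\xi_2$ are random measures, possibly defined on different probability spaces, with $L_{\xi_1}[f]=L_{\xi_2}[f]$ for all $f\in BM(\mathbb S)$, then $\xi_1$ and $\xi_2$ have the same distribution on $(\mathbb M_{\mathbb O},\mathcal M_{\mathbb O})$. Likewise, if $N_1,N_2$ are point processes, possibly defined on different probability spaces, with $L_{N_1}[f]=L_{N_2}[f]$ for all $f\in BM(\mathbb S)$, then $N_1$ and $N_2$ have the same distribution on $(\mathbb N_{\mathbb O},\mathcal N_{\mathbb O})$. -/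

import Mathlib

open MeasureTheory

noncomputable section

/-- The space `𝕆 = 𝕊 \ ℂ`, with the induced Borel structure (the Borel sets of `𝕊` inside `𝕆`). -/
abbrev OSpace {S : Type*} (C : Set S) : Type _ := {x : S // x ∉ C}

/-- The class `𝒞_𝕆` of non-negative bounded continuous functions on `𝕆` vanishing on
`ℂ^r = {x : d(x, ℂ) < r}` for some `r > 0`; `Metric.thickening r C` is `ℂ^r`. -/
def ContO {S : Type*} [MetricSpace S] (C : Set S) : Set (OSpace C → ℝ) :=
  {f | Continuous f ∧ (∀ x, 0 ≤ f x) ∧ (∃ M : ℝ, ∀ x, f x ≤ M) ∧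
    ∃ r : ℝ, 0 < r ∧ ∀ x : OSpace C, x.1 ∈ Metric.thickening r C → f x = 0}

/-- The class `BM(𝕊)` of non-negative bounded measurable functions vanishing on `ℂ^r` for
some `r > 0`. -/
def BM {S : Type*} [MetricSpace S] [MeasurableSpace S] (C : Set S) : Set (S → ℝ) :=
  {f | Measurable f ∧ (∀ x, 0 ≤ f x) ∧ (∃ M : ℝ, ∀ x, f x ≤ M) ∧
    ∃ r : ℝ, 0 < r ∧ ∀ x ∈ Metric.thickening r C, f x = 0}

/-- The space `𝕄_𝕆` of Borel measures on `𝕆` that are finite on `𝕊 \ ℂ^r` for every `r > 0`.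
(A structure, so that it carries only the σ-algebra declared below.) -/
structure MO {S : Type*} [MetricSpace S] [MeasurableSpace S] (C : Set S) where
  /-- the underlying measure on `𝕆` -/
  toMeasure : Measure (OSpace C)
  finite_away : ∀ r : ℝ, 0 < r →
    toMeasure {x : OSpace C | x.1 ∉ Metric.thickening r C} < ⊤

/-- The basic neighborhood
`{υ ∈ 𝕄_𝕆 : |∫ fᵢ dυ - ∫ fᵢ dμ| < ε, i = 1, …, k}` of `μ ∈ 𝕄_𝕆`. -/
def MO.nhd {S : Type*} [MetricSpace S] [MeasurableSpace S] {C : Set S}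
    (μ : MO C) (k : ℕ) (f : Fin k → OSpace C → ℝ) (ε : ℝ) : Set (MO C) :=
  {υ | ∀ i, |(∫ x, f i x ∂υ.toMeasure) - ∫ x, f i x ∂μ.toMeasure| < ε}

/-- The σ-algebra `ℳ_𝕆` generated by the basic neighborhoods given by functions in `𝒞_𝕆`. -/
instance MO.instMeasurableSpace {S : Type*} [MetricSpace S] [MeasurableSpace S] (C : Set S) :
    MeasurableSpace (MO C) :=
  MeasurableSpace.generateFrom
    {U | ∃ (μ : MO C) (k : ℕ) (f : Fin k → OSpace C → ℝ) (ε : ℝ),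
      (∀ i, f i ∈ ContO C) ∧ 0 < ε ∧ U = μ.nhd k f ε}

/-- The space `ℕ_𝕆` of counting measures: those `N ∈ 𝕄_𝕆` such that `N (A \ ℂ^r)` is a
non-negative integer for all `r > 0` and all Borel `A ⊆ 𝕊`. As a subtype of `𝕄_𝕆` it carries
the trace of `ℳ_𝕆`. -/
def NO {S : Type*} [MetricSpace S] [MeasurableSpace S] (C : Set S) : Set (MO C) :=
  {N | ∀ r : ℝ, 0 < r → ∀ A : Set S, MeasurableSet A →
    ∃ n : ℕ, N.toMeasure {x : OSpace C | x.1 ∈ A \ Metric.thickening r C} = n}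

/-- The Laplace functional `L_ξ[f] = E[exp(-∫_𝕆 f dξ)]` of `ξ : Ω → 𝕄_𝕆` under `P`. -/
def laplaceFunctional {S : Type*} [MetricSpace S] [MeasurableSpace S] {C : Set S}
    {Ω : Type*} [MeasurableSpace Ω] (P : Measure Ω) (ξ : Ω → MO C) (f : S → ℝ) : ℝ :=
  ∫ ω, Real.exp (-∫ x : OSpace C, f x.1 ∂(ξ ω).toMeasure) ∂P

end

open scoped NNReal BoundedContinuousFunction

/-- A measure is determined by its push-forward along a map that generates the σ-algebra. -/
theorem MeasureTheory.Measure.ext_of_map_eq_of_comap_le {X Y : Type*} [mX : MeasurableSpace X]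
    [mY : MeasurableSpace Y] {g : X → Y} (hg : Measurable g) (hle : mX ≤ mY.comap g)
    {μ ν : Measure X} (h : μ.map g = ν.map g) : μ = ν := by
  ext s hs
  obtain ⟨t, ht, rfl⟩ := hle s hs
  rw [← Measure.map_apply hg ht, ← Measure.map_apply hg ht, h]

section Laplace

variable {ι : Type*}

/-- The function `x ↦ exp (-xᵢ)` on the positive orthant. -/
noncomputable def expNegCoord (i : ι) : (ι → ℝ≥0) →ᵇ ℝ :=
  BoundedContinuousFunction.ofNormedAddCommGroup (fun x => Real.exp (-(x i : ℝ))) (by fun_prop) 1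
    (fun x => by simp [abs_of_pos (Real.exp_pos _)])

@[simp]
theorem expNegCoord_apply (i : ι) (x : ι → ℝ≥0) : expNegCoord i x = Real.exp (-(x i : ℝ)) := rfl

theorem exists_eq_exp_of_mem_closure_expNegCoord [Fintype ι] {g : (ι → ℝ≥0) →ᵇ ℝ}
    (hg : g ∈ Submonoid.closure (Set.range (expNegCoord (ι := ι)))) :
    ∃ n : ι → ℕ, ∀ x, g x = Real.exp (-∑ i, (n i : ℝ) * x i) := by
  classical
  induction hg using Submonoid.closure_induction with
  | mem g hg =>
    obtain ⟨i, rfl⟩ := hg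
    exact ⟨Pi.single i 1, fun x => by simp [Pi.single_apply]⟩
  | one => exact ⟨0, fun x => by simp⟩
  | mul g g' _ _ ih ih' =>
    obtain ⟨n, hn⟩ := ih
    obtain ⟨n', hn'⟩ := ih'
    refine ⟨n + n', fun x => ?_⟩
    rw [BoundedContinuousFunction.mul_apply, hn, hn', ← Real.exp_add]
    simp [add_mul, Finset.sum_add_distrib]
    ring

/-- A finite measure on the positive orthant is determined by its Laplace transform at vectors of
natural numbers. -/
theorem MeasureTheory.Measure.ext_of_integral_exp_neg_eq [Fintype ι]
    {μ ν : Measure (ι → ℝ≥0)} [IsFiniteMeasure μ] [IsFiniteMeasure ν]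
    (h : ∀ n : ι → ℕ, ∫ x, Real.exp (-∑ i, (n i : ℝ) * x i) ∂μ =
      ∫ x, Real.exp (-∑ i, (n i : ℝ) * x i) ∂ν) : μ = ν := by
  set E : Set ((ι → ℝ≥0) →ᵇ ℝ) := Set.range expNegCoord
  refine ext_of_forall_mem_subalgebra_integral_eq_of_pseudoEMetric_complete_countable (𝕜 := ℝ)
    (A := StarAlgebra.adjoin ℝ E) ?_ ?_
  · intro x y hxy
    obtain ⟨i, hi⟩ := Function.ne_iff.mp hxy
    refine ⟨_, ⟨_, ⟨expNegCoord i, StarAlgebra.subset_adjoin ℝ E ⟨i, rfl⟩, rfl⟩, rfl⟩, ?_⟩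
    intro hexp
    exact hi (NNReal.coe_injective (neg_injective (Real.exp_injective hexp)))
  · intro g hg
    have hstar : star E = E := by
      have : ∀ g : (ι → ℝ≥0) →ᵇ ℝ, star g = g := fun g => by ext; simp
      ext g
      rw [Set.mem_star, this]
    have hspan : g ∈ Submodule.span ℝ (Submonoid.closure E : Set ((ι → ℝ≥0) →ᵇ ℝ)) := by
      have := StarAlgebra.adjoin_eq_span (R := ℝ) E
      rw [hstar, Set.union_self] at this
      rw [← this]
      exact hg
    clear hg
    induction hspan using Submodule.span_induction with
    | mem g hg =>
      obtain ⟨n, hn⟩ := exists_eq_exp_of_mem_closure_expNegCoord hg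
      simpa only [hn] using h n
    | zero => simp
    | add g g' _ _ ih ih' =>
      simp only [BoundedContinuousFunction.add_apply]
      rw [integral_add (g.integrable μ) (g'.integrable μ),
        integral_add (g.integrable ν) (g'.integrable ν), ih, ih']
    | smul c g _ ih =>
      simp only [BoundedContinuousFunction.smul_apply, integral_smul, ih]

end Laplace

section RandomMeasure

variable {S : Type*} [MetricSpace S] {C : Set S}

variable (C) in
/-- The class `ContO C` as an additive monoid of functions. -/
def ContO.addSubmonoid : AddSubmonoid (OSpace C → ℝ) where
  carrier := ContO C
  zero_mem' := ⟨continuous_const, fun _ => le_rfl, ⟨0, fun _ => le_rfl⟩, 1, one_pos, fun _ _ => rfl⟩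
  add_mem' := by
    rintro f g ⟨hf, hf0, ⟨M, hM⟩, r, hr, hfr⟩ ⟨hg, hg0, ⟨M', hM'⟩, r', hr', hgr⟩
    refine ⟨hf.add hg, fun x => add_nonneg (hf0 x) (hg0 x),
      ⟨M + M', fun x => add_le_add (hM x) (hM' x)⟩, min r r', lt_min hr hr', fun x hx => ?_⟩
    simp [hfr x (Metric.thickening_mono (min_le_left _ _) C hx),
      hgr x (Metric.thickening_mono (min_le_right _ _) C hx)]

variable [MeasurableSpace S]

theorem ContO.extend_mem_BM [BorelSpace S] (hC : IsClosed C) {f : OSpace C → ℝ} (hf : f ∈ ContO C) :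
    Function.extend Subtype.val f 0 ∈ BM C := by
  obtain ⟨hf, hf0, ⟨M, hM⟩, r, hr, hfr⟩ := hf
  have key : ∀ x : S, (∃ y : OSpace C, y.1 = x ∧ Function.extend Subtype.val f 0 x = f y) ∨
      Function.extend Subtype.val f 0 x = 0 := fun x => by
    by_cases hx : x ∈ C
    · exact .inr (Function.extend_apply' _ _ _ fun ⟨y, hy⟩ => y.2 (hy ▸ hx))
    · exact .inl ⟨⟨x, hx⟩, rfl, Subtype.val_injective.extend_apply f 0 ⟨x, hx⟩⟩
  refine ⟨(MeasurableEmbedding.subtype_coe hC.measurableSet.compl).measurable_extend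
    hf.measurable measurable_const, fun x => ?_, ⟨max M 0, fun x => ?_⟩, r, hr, fun x hx => ?_⟩
  · rcases key x with ⟨y, -, h⟩ | h
    · exact h ▸ hf0 y
    · exact h.ge
  · rcases key x with ⟨y, -, h⟩ | h
    · exact h ▸ (hM y).trans (le_max_left _ _)
    · exact h ▸ le_max_right _ _
  · rcases key x with ⟨y, rfl, h⟩ | h
    · exact h.trans (hfr y hx)
    · exact h

theorem MO.integrable [BorelSpace S] (μ : MO C) {f : OSpace C → ℝ} (hf : f ∈ ContO C) :
    Integrable f μ.toMeasure := by
  obtain ⟨hf, hf0, ⟨M, hM⟩, r, hr, hfr⟩ := hf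
  have hs : MeasurableSet {x : OSpace C | x.1 ∉ Metric.thickening r C} :=
    (Metric.isOpen_thickening.preimage continuous_subtype_val).measurableSet.compl
  refine (integrableOn_iff_integrable_of_support_subset
    (s := {x : OSpace C | x.1 ∉ Metric.thickening r C}) fun x hx hxr => hx (hfr x hxr)).mp ?_
  exact Measure.integrableOn_of_bounded (M := M) (μ.finite_away r hr).ne
    hf.measurable.aestronglyMeasurable
    (.of_forall fun x => by rw [Real.norm_of_nonneg (hf0 x)]; exact hM x)

/-- The integrals of a measure against all functions in `ContO C`. -/
noncomputable def MO.integrals (μ : MO C) (f : ContO C) : ℝ≥0 :=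
  ⟨∫ x, f.1 x ∂μ.toMeasure, integral_nonneg f.2.2.1⟩

theorem MO.measurable_integrals : Measurable (MO.integrals (C := C)) := by
  refine measurable_pi_lambda _ fun f => measurable_of_Iio fun t => ?_
  rcases eq_or_ne t 0 with rfl | ht
  · simp
  refine MeasurableSpace.measurableSet_generateFrom
    ⟨⟨0, by simp⟩, 1, fun _ => f.1, t, fun _ => f.2, by positivity, ?_⟩
  ext υ
  have h0 : 0 ≤ ∫ x, f.1 x ∂υ.toMeasure := integral_nonneg f.2.2.1
  simp only [MO.nhd, integral_zero_measure, sub_zero, abs_of_nonneg h0, forall_const,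
    Set.mem_ofPred_eq]
  exact NNReal.coe_lt_coe.symm

theorem MO.measurableSpace_le_comap_integrals :
    MO.instMeasurableSpace C ≤ MeasurableSpace.pi.comap (MO.integrals (C := C)) := by
  refine MeasurableSpace.generateFrom_le ?_
  rintro _ ⟨μ, k, f, ε, hf, -, rfl⟩
  refine ⟨{y | ∀ i, |(y ⟨f i, hf i⟩ : ℝ) - ∫ x, f i x ∂μ.toMeasure| < ε}, ?_, rfl⟩
  rw [Set.ofPred_forall]
  exact .iInter fun i => measurableSet_lt (by fun_prop) measurable_const

theorem MO.integral_sum_nsmul [BorelSpace S] (μ : MO C) {I : Finset (ContO C)} (n : I → ℕ) :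
    ∫ x, (∑ i, n i • i.1.1) x ∂μ.toMeasure = ∑ i : I, (n i : ℝ) * μ.integrals i := by
  simp only [Finset.sum_apply, Pi.smul_apply, ← Nat.cast_smul_eq_nsmul ℝ, smul_eq_mul]
  rw [integral_finsetSum _ fun i _ => (μ.integrable i.1.2).const_mul _]
  exact Finset.sum_congr rfl fun i _ => integral_const_mul _ _

/-- The law of a random measure is determined by its Laplace functional. -/
theorem MO.map_eq_of_laplaceFunctional_eq [BorelSpace S] (hC : IsClosed C)
    {Ω₁ Ω₂ : Type*} [MeasurableSpace Ω₁] [MeasurableSpace Ω₂]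
    {P₁ : Measure Ω₁} {P₂ : Measure Ω₂} [IsFiniteMeasure P₁] [IsFiniteMeasure P₂]
    {ξ₁ : Ω₁ → MO C} {ξ₂ : Ω₂ → MO C} (h₁ : Measurable ξ₁) (h₂ : Measurable ξ₂)
    (h : ∀ f ∈ BM C, laplaceFunctional P₁ ξ₁ f = laplaceFunctional P₂ ξ₂ f) :
    P₁.map ξ₁ = P₂.map ξ₂ := by
  refine Measure.ext_of_map_eq_of_comap_le MO.measurable_integrals
    MO.measurableSpace_le_comap_integrals ?_
  refine IsProjectiveLimit.unique
    (P := fun I => ((P₂.map ξ₂).map MO.integrals).map I.restrict) (fun I => ?_) fun _ => rfl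
  refine Measure.ext_of_integral_exp_neg_eq fun n => ?_
  have hI := MO.measurable_integrals (C := C)
  have hr : Measurable (I.restrict (π := fun _ => ℝ≥0)) := Finset.measurable_restrict I
  have hmem : ∑ i : I, n i • i.1.1 ∈ ContO C :=
    sum_mem (S := ContO.addSubmonoid C) fun i _ => nsmul_mem i.1.2 _
  have key := h _ (ContO.extend_mem_BM hC hmem)
  simp only [laplaceFunctional, Subtype.val_injective.extend_apply, MO.integral_sum_nsmul] at key
  have hm : Measurable fun x : I → ℝ≥0 => Real.exp (-∑ i, (n i : ℝ) * x i) := by fun_prop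
  beta_reduce
  rw [Measure.map_map hI h₁, Measure.map_map hr (hI.comp h₁), Measure.map_map hI h₂,
    Measure.map_map hr (hI.comp h₂),
    integral_map (hr.comp (hI.comp h₁)).aemeasurable hm.aestronglyMeasurable,
    integral_map (hr.comp (hI.comp h₂)).aemeasurable hm.aestronglyMeasurable]
  exact key

end RandomMeasure

theorem theorem3p2 {S : Type*} [MetricSpace S] [CompleteSpace S]
    [TopologicalSpace.SeparableSpace S] [MeasurableSpace S] [BorelSpace S]
    (C : Set S) (hC : IsClosed C)
    {Ω₁ Ω₂ : Type*} [MeasurableSpace Ω₁] [MeasurableSpace Ω₂]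
    (P₁ : Measure Ω₁) (P₂ : Measure Ω₂) [IsProbabilityMeasure P₁] [IsProbabilityMeasure P₂] :
    -- random measures
    (∀ (ξ₁ : Ω₁ → MO C) (ξ₂ : Ω₂ → MO C), Measurable ξ₁ → Measurable ξ₂ →
      (∀ f ∈ BM C, laplaceFunctional P₁ ξ₁ f = laplaceFunctional P₂ ξ₂ f) →
      P₁.map ξ₁ = P₂.map ξ₂) ∧
    -- point processes
    (∀ (N₁ : Ω₁ → NO C) (N₂ : Ω₂ → NO C), Measurable N₁ → Measurable N₂ →
      (∀ f ∈ BM C, laplaceFunctional P₁ (fun ω => (N₁ ω : MO C)) f =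
        laplaceFunctional P₂ (fun ω => (N₂ ω : MO C)) f) →
      P₁.map N₁ = P₂.map N₂) := by
  refine ⟨fun ξ₁ ξ₂ h₁ h₂ h => MO.map_eq_of_laplaceFunctional_eq hC h₁ h₂ h,
    fun N₁ N₂ h₁ h₂ h => Measure.ext_of_map_eq_of_comap_le measurable_subtype_coe le_rfl ?_⟩
  rw [Measure.map_map measurable_subtype_coe h₁, Measure.map_map measurable_subtype_coe h₂]
  exact MO.map_eq_of_laplaceFunctional_eq hC (measurable_subtype_coe.comp h₁)
    (measurable_subtype_coe.comp h₂) h
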